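/- Write $\mathcal S_n$ for the set of permutations of $\{1,\dots,n\}$. Let $k\ge 3$ and $2\le i\le k-1$. Let $\sigma=\sigma_1\sigma_2\cdots\sigma_{k+1}\in\mathcal S_{k+1}$ be a permutation with $\sigma_1<\sigma_2<\cdots<\sigma_{i-1}<\sigma_i>\sigma_{i+1}>\cdots>\sigma_k$ and $\sigma_{k+1}=k+1$, and let $\tau=\tau_1\tau_2\cdots\tau_{k+1}$ be obtained from $\sigma$ by interchanging the letters $k$ and $k+1$ (so $\tau_{k+1}=k$). Then the vincular patterns $$\tau_1\tau_2\cdots\tau_k\text{-}k\qquad\text{and}\qquad \tau_k\cdots\tau_2\tau_1\text{-}k$$ are Wilf-equivalent: for every $n\ge 0$, the number of permutations in $\mathcal S_n$ that avoid the first pattern equals the number of permutations in $\mathcal S_n$ that avoid the second. Here, for a permutation $\rho=\rho_1\cdots\rho_{k+1}$ of $\{1,\dots,k+1\}$, a permutation $\pi\in\mathcal S_n$ avoids the vincular pattern $\rho_1\rho_2\cdots\rho_k\text{-}\rho_{k+1}$ if there are no indices $1\le j_1<j_2<\cdots<j_{k+1}\le n$ with $j_{m+1}=j_m+1$ for $1\le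 m\le k-1$ such that $\pi_{j_1}\pi_{j_2}\cdots\pi_{j_{k+1}}$ is order-isomorphic to $\rho$. -/

import Mathlib

/-- A vincular pattern `(σ, X)` of length `k`: a permutation `σ` of `k` letters and a set `X` of
adjacencies.  Positions and letters are counted from `0`, so `j ∈ X` (with `j + 1 < k`) means that
there is no dash between the letters in positions `j` and `j + 1`. -/
structure VincularPattern (k : ℕ) where
  /-- the underlying permutation, in one-line notation -/
  perm : Equiv.Perm (Fin k)
  /-- the set of adjacencies -/
  adj : Finset ℕ
  adj_subset : adj ⊆ Finset.range (k - 1)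

namespace VincularPattern

/-- The subsequence of `π` in positions `f 0 < f 1 < ⋯ < f (k - 1)` is a copy of `p`: it is
order-isomorphic to the underlying permutation, and the required positions are consecutive. -/
def IsCopy {k n : ℕ} (p : VincularPattern k) (π : Equiv.Perm (Fin n)) (f : Fin k → Fin n) : Prop :=
  StrictMono f ∧
  (∀ a b : Fin k, π (f a) < π (f b) ↔ p.perm a < p.perm b) ∧
  (∀ a b : Fin k, (a : ℕ) ∈ p.adj → (b : ℕ) = (a : ℕ) + 1 → (f b : ℕ) = (f a : ℕ) + 1)

/-- `π` avoids `p`: no subsequence of `π` is a copy of `p`. -/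
def Avoids {k n : ℕ} (p : VincularPattern k) (π : Equiv.Perm (Fin n)) : Prop :=
  ¬ ∃ f : Fin k → Fin n, p.IsCopy π f

/-- The set of permutations of length `n` that avoid `p`. -/
def avoiders {k : ℕ} (p : VincularPattern k) (n : ℕ) : Set (Equiv.Perm (Fin n)) :=
  {π | p.Avoids π}

/-- Wilf-equivalence of vincular patterns. -/
def WilfEquiv {k l : ℕ} (p : VincularPattern k) (q : VincularPattern l) : Prop :=
  ∀ n : ℕ, (p.avoiders n).ncard = (q.avoiders n).ncard

/-- The vincular pattern `τ₁τ₂⋯τₖ-τₖ₊₁`, whose only dash is before the last letter. -/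
def dashLast {k : ℕ} (τ : Equiv.Perm (Fin (k + 1))) : VincularPattern (k + 1) where
  perm := τ
  adj := Finset.range (k - 1)
  adj_subset := Finset.range_subset_range.2 (by omega)

end VincularPattern

/-- The permutation of the `k + 1` positions that reverses the order of the first `k` positions and
fixes the last one. -/
def revInitialPos (k : ℕ) : Equiv.Perm (Fin (k + 1)) :=
  Function.Involutive.toPerm
    (Fin.lastCases (Fin.last k) (fun a : Fin k => a.rev.castSucc)) (by
      intro x
      refine Fin.lastCases ?_ (fun a => ?_) x <;> simp)

/-- The permutation `τₖ⋯τ₂τ₁τₖ₊₁` obtained from `τ₁τ₂⋯τₖτₖ₊₁` by reversing its first `k` letters. -/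
def revInitial {k : ℕ} (τ : Equiv.Perm (Fin (k + 1))) : Equiv.Perm (Fin (k + 1)) :=
  τ * revInitialPos k

/-! Read a permutation from right to left and record each letter by its rank among the letters read
so far; `rk` recovers ranks from such codes. The letter after the dash now precedes the block, and a
copy of the pattern becomes a hit (`HitAt`): `l + 1 = k` consecutive letters ordered like the peaked
word, the peak exceeding the others by at least two ranks, so that an earlier letter fits in
between. Being a hit depends only on the codes inside the block.

Two distinct hits share at most one letter (`IsPeaked.not_overlap`), so overlapping hits form
chains. The recursion `IsPeaked.tailCount_rec` then determines the number of avoiders from the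
numbers `chainCount` (`tailCount_eq`), and it suffices that these do not change when the word is
reversed.

Lowering the code of every peak by one turns the gap of two into mere domination. Hence chains of
hits over `R + 1` earlier letters biject with chains of plain consecutive occurrences over `R`
earlier letters (`IsPeaked.chainCount_succ`). Plain occurrences ignore the earlier letters, so
reversing the positions of the chain gives the symmetry (`freeChainCount_rev`). -/

/-! ### Ranks under successive insertion -/

/-- The order embedding of `ℕ` into itself that misses exactly `a`. -/
def skip (a x : ℕ) : ℕ := if x < a then x else x + 1

theorem skip_lt_skip {a x y : ℕ} : skip a x < skip a y ↔ x < y := by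
  unfold skip; split_ifs <;> omega

theorem skip_ne (a x : ℕ) : skip a x ≠ a := by
  unfold skip; split_ifs <;> omega

theorem skip_injective (a : ℕ) : Function.Injective (skip a) := by
  intro x y h
  unfold skip at h; split_ifs at h <;> omega

theorem le_skip (a x : ℕ) : x ≤ skip a x := by
  unfold skip; split_ifs <;> omega

theorem skip_le (a x : ℕ) : skip a x ≤ x + 1 := by
  unfold skip; split_ifs <;> omega

/-- Insert letters `0, 1, 2, …` one after another into a linear order, letter `n` having `c n`
smaller letters at the time of its insertion.  Then `rk c n s` is the rank of the letter `s` when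
the first `n` letters have been inserted. -/
def rk (c : ℕ → ℕ) : ℕ → ℕ → ℕ
  | 0, _ => 0
  | n + 1, s => if s = n then c n else skip (c n) (rk c n s)

theorem rk_succ_self (c : ℕ → ℕ) (n : ℕ) : rk c (n + 1) n = c n := by
  simp [rk]

theorem rk_succ_of_lt (c : ℕ → ℕ) {n s : ℕ} (h : s < n) :
    rk c (n + 1) s = skip (c n) (rk c n s) := by
  simp [rk, h.ne]

/-- Locality: letters inserted before `s` influence its rank only through the code values from `s`
on. This is what makes the counts below multiply. -/
theorem rk_congr {c d : ℕ → ℕ} {n s : ℕ} (hs : s < n) (h : ∀ i, s ≤ i → i < n → c i = d i) :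
    rk c n s = rk d n s := by
  induction n with
  | zero => omega
  | succ n ih =>
    rcases Nat.lt_succ_iff_lt_or_eq.1 hs with h1 | rfl
    · rw [rk_succ_of_lt _ h1, rk_succ_of_lt _ h1, h n h1.le (by omega),
        ih h1 fun i hi hi' => h i hi (by omega)]
    · rw [rk_succ_self, rk_succ_self, h s le_rfl (by omega)]

theorem rk_shift (c : ℕ → ℕ) (r : ℕ) {n s : ℕ} (hs : s < n) :
    rk (fun j => c (r + j)) n s = rk c (r + n) (r + s) := by
  induction n with
  | zero => omega
  | succ n ih =>
    rcases Nat.lt_succ_iff_lt_or_eq.1 hs with h1 | rfl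
    · rw [rk_succ_of_lt _ h1, ih h1, ← add_assoc, rk_succ_of_lt _ (by omega)]
    · rw [rk_succ_self, ← add_assoc, rk_succ_self]

theorem rk_lt_rk_iff (c : ℕ → ℕ) {n N s t : ℕ} (hs : s < n) (ht : t < n) (hN : n ≤ N) :
    rk c N s < rk c N t ↔ rk c n s < rk c n t := by
  induction N, hN using Nat.le_induction with
  | base => rfl
  | succ N hN ih =>
    rw [rk_succ_of_lt _ (by omega), rk_succ_of_lt _ (by omega), skip_lt_skip, ih]

theorem rk_injOn (c : ℕ → ℕ) {n s t : ℕ} (hs : s < n) (ht : t < n) (h : rk c n s = rk c n t) :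
    s = t := by
  induction n with
  | zero => omega
  | succ n ih =>
    rcases Nat.lt_succ_iff_lt_or_eq.1 hs with h1 | rfl <;>
    rcases Nat.lt_succ_iff_lt_or_eq.1 ht with h2 | rfl
    · rw [rk_succ_of_lt _ h1, rk_succ_of_lt _ h2] at h
      exact ih h1 h2 (skip_injective _ h)
    · rw [rk_succ_of_lt _ h1, rk_succ_self] at h
      exact (skip_ne _ _ h).elim
    · rw [rk_succ_of_lt _ h2, rk_succ_self] at h
      exact (skip_ne _ _ h.symm).elim
    · rfl

theorem rk_le {c : ℕ → ℕ} {R n s : ℕ} (hc : ∀ j < n, c j ≤ R + j) (hs : s < n) :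
    rk c n s + 1 ≤ R + n := by
  induction n with
  | zero => omega
  | succ n ih =>
    rcases Nat.lt_succ_iff_lt_or_eq.1 hs with h1 | rfl
    · rw [rk_succ_of_lt _ h1]
      have := ih (fun j hj => hc j (by omega)) h1
      have := skip_le (c n) (rk c n s)
      omega
    · rw [rk_succ_self]
      have := hc s hs
      omega

/-! ### Counting codes, and their bijection with permutations -/

/-- The codes of length `L` that describe insertions into an order with `r` letters. -/
def codes (r L : ℕ) : Set (ℕ → ℕ) :=
  {e | (∀ j < L, e j ≤ r + j) ∧ ∀ j, L ≤ j → e j = 0}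

theorem codes_finite (r L : ℕ) : (codes r L).Finite := by
  have : Set.Finite (Set.univ.pi fun _ : Fin L => Set.Iic (r + L)) :=
    Set.Finite.pi fun _ => Set.finite_Iic _
  refine Set.Finite.of_injOn (f := fun e (j : Fin L) => e j) ?_ ?_ this
  · intro e he j _
    have := he.1 j j.2
    simp only [Set.mem_Iic]
    omega
  · intro e he d hd h
    funext j
    by_cases hj : j < L
    · exact congrFun h ⟨j, hj⟩
    · rw [he.2 j (by omega), hd.2 j (by omega)]

/-- A code may be cut at `A`: the bounds on its entries are independent, and the second piece sees
`r + A` letters already present. -/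
theorem ncard_codes_add (r A B : ℕ) (p q : (ℕ → ℕ) → Prop)
    (hp : ∀ c d : ℕ → ℕ, (∀ j < A, c j = d j) → (p c ↔ p d)) :
    {c | c ∈ codes r (A + B) ∧ p c ∧ q (fun j => c (A + j))}.ncard =
      {c | c ∈ codes r A ∧ p c}.ncard * {e | e ∈ codes (r + A) B ∧ q e}.ncard := by
  rw [← Set.ncard_prod]
  symm
  refine Set.ncard_congr (fun x _ j => if j < A then x.1 j else x.2 (j - A)) ?_ ?_ ?_
  · rintro ⟨c, e⟩ ⟨⟨hc, hpc⟩, he, hqe⟩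
    refine ⟨⟨fun j hj => ?_, fun j hj => ?_⟩, ?_, ?_⟩
    · dsimp only
      split_ifs with h
      · exact hc.1 j h
      · have := he.1 (j - A) (by omega)
        dsimp only at this ⊢
        omega
    · dsimp only
      rw [if_neg (by omega)]
      exact he.2 _ (by omega)
    · refine (hp _ _ fun j hj => ?_).1 hpc
      simp [hj]
    · simpa using hqe
  · rintro ⟨c, e⟩ ⟨c', e'⟩ ⟨⟨hc, -⟩, he, -⟩ ⟨⟨hc', -⟩, he', -⟩ h
    have h' := fun j => congrFun h j
    dsimp only at h' hc hc'
    refine Prod.ext (funext fun j => ?_) (funext fun j => ?_)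
    · by_cases hj : j < A
      · simpa [hj] using h' j
      · exact (hc.2 j (by omega)).trans (hc'.2 j (by omega)).symm
    · simpa using h' (A + j)
  · rintro c ⟨hc, hpc, hqc⟩
    refine ⟨(fun j => if j < A then c j else 0, fun j => c (A + j)), ⟨⟨⟨?_, ?_⟩, ?_⟩, ⟨?_, ?_⟩, hqc⟩, ?_⟩
    · intro j hj
      simpa [hj] using hc.1 j (by omega)
    · intro j hj
      simp [hj.not_gt]
    · refine (hp _ _ fun j hj => ?_).1 hpc
      simp [hj]
    · intro j hj
      have := hc.1 (A + j) (by omega)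
      dsimp only
      omega
    · intro j hj
      exact hc.2 _ (by omega)
    · funext j
      dsimp only
      split_ifs with h
      · rfl
      · congr 1; omega

theorem ncard_codes_one (r : ℕ) : (codes r 1).ncard = r + 1 := by
  rw [← Set.ncard_Iic_nat r]
  refine Set.ncard_congr (fun e _ => e 0) ?_ ?_ ?_
  · intro e he
    simpa using he.1 0 (by omega)
  · intro e d he hd h
    funext j
    rcases Nat.eq_zero_or_pos j with rfl | hj
    · exact h
    · rw [he.2 j hj, hd.2 j hj]
  · intro b hb
    refine ⟨fun j => if j = 0 then b else 0, ⟨fun j hj => ?_, fun j hj => ?_⟩, by simp⟩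
    · obtain rfl : j = 0 := by omega
      simpa using hb
    · simp; omega

theorem ncard_codes (N : ℕ) : (codes 0 N).ncard = N.factorial := by
  induction N with
  | zero =>
    rw [Nat.factorial_zero, Set.ncard_eq_one]
    refine ⟨fun _ => 0, Set.eq_singleton_iff_unique_mem.2 ⟨⟨by simp, by simp⟩, ?_⟩⟩
    exact fun e he => funext fun j => he.2 j (Nat.zero_le _)
  | succ N ih =>
    have := ncard_codes_add 0 N 1 (fun _ => True) (fun _ => True) (by simp)
    simp only [and_true, Set.ofPred_mem_eq, zero_add, ncard_codes_one] at this
    rw [this, ih, Nat.factorial_succ, mul_comm]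

theorem eq_of_rk_eq {c d : ℕ → ℕ} {N : ℕ} (h : ∀ s < N, rk c N s = rk d N s) :
    ∀ i < N, c i = d i := by
  induction N with
  | zero => intro i hi; omega
  | succ N ih =>
    have hN : c N = d N := by simpa [rk_succ_self] using h N (by omega)
    intro i hi
    rcases Nat.lt_succ_iff_lt_or_eq.1 hi with h1 | rfl
    · refine ih (fun s hs => ?_) i h1
      have := h s (by omega)
      rw [rk_succ_of_lt _ hs, rk_succ_of_lt _ hs, hN] at this
      exact skip_injective _ this
    · exact hN

/-- The permutation described by a code. -/
noncomputable def codePerm (N : ℕ) (c : codes 0 N) : Equiv.Perm (Fin N) :=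
  Equiv.ofBijective
    (fun s => ⟨rk c N s, by have := rk_le (R := 0) (fun j hj => c.2.1 j hj) s.2; omega⟩)
    (Finite.injective_iff_bijective.1 fun s t h =>
      Fin.ext (rk_injOn c s.2 t.2 (congrArg Fin.val h)))

theorem codePerm_apply (N : ℕ) (c : codes 0 N) (s : Fin N) : (codePerm N c s : ℕ) = rk c N s := rfl

theorem codePerm_bijective (N : ℕ) : Function.Bijective (codePerm N) := by
  have : Finite (codes 0 N) := codes_finite 0 N
  have := Fintype.ofFinite (codes 0 N)
  rw [Fintype.bijective_iff_injective_and_card]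
  constructor
  · intro c d h
    refine Subtype.ext (funext fun i => ?_)
    by_cases hi : i < N
    · refine eq_of_rk_eq (N := N) (fun s hs => ?_) i hi
      rw [← codePerm_apply N c ⟨s, hs⟩, h, codePerm_apply]
    · rw [c.2.2 i (by omega), d.2.2 i (by omega)]
  · rw [Fintype.card_perm, Fintype.card_fin, ← ncard_codes, ← Nat.card_coe_set_eq,
      Nat.card_eq_fintype_card]

theorem ncard_perm_eq (N : ℕ) (p : Equiv.Perm (Fin N) → Prop) (q : (ℕ → ℕ) → Prop)
    (h : ∀ c : codes 0 N, p (codePerm N c) ↔ q c) :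
    {w | p w}.ncard = {c | c ∈ codes 0 N ∧ q c}.ncard := by
  symm
  refine Set.ncard_congr (fun c hc => codePerm N ⟨c, hc.1⟩) ?_ ?_ ?_
  · exact fun c hc => (h ⟨c, hc.1⟩).2 hc.2
  · intro c d hc hd hcd
    exact congrArg Subtype.val ((codePerm_bijective N).1 hcd)
  · intro w hw
    obtain ⟨c, rfl⟩ := (codePerm_bijective N).2 w
    exact ⟨c, ⟨c.2, (h c).1 hw⟩, rfl⟩

/-! ### Peaked words, occurrences and hits -/

/-- A word of `l + 1` letters that increases up to position `P` and decreases afterwards. -/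
structure IsPeaked (l P : ℕ) (ρ : ℕ → ℕ) : Prop where
  pos : 0 < P
  lt : P < l
  up : ∀ a b, a < b → b ≤ P → ρ a < ρ b
  down : ∀ a b, P ≤ a → a < b → b ≤ l → ρ b < ρ a

theorem IsPeaked.lt_peak {l P : ℕ} {ρ : ℕ → ℕ} (h : IsPeaked l P ρ) {a : ℕ} (ha : a ≤ l)
    (haP : a ≠ P) : ρ a < ρ P := by
  rcases lt_or_gt_of_ne haP with h1 | h1
  · exact h.up a P h1 le_rfl
  · exact h.down P a le_rfl h1 ha

theorem IsPeaked.rev {l P : ℕ} {ρ : ℕ → ℕ} (h : IsPeaked l P ρ) :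
    IsPeaked l (l - P) (fun a => ρ (l - a)) where
  pos := by have := h.lt; omega
  lt := by have := h.pos; have := h.lt; omega
  up a b hab hb := by
    have := h.lt
    exact h.down (l - b) (l - a) (by omega) (by omega) (by omega)
  down a b ha hab hb := by
    have := h.lt
    exact h.up (l - b) (l - a) (by omega) (by omega)

/-- The letters `r, …, r + l` of the code `c` are ordered like `ρ 0, …, ρ l`. -/
def OccursAt (l : ℕ) (ρ : ℕ → ℕ) (c : ℕ → ℕ) (r : ℕ) : Prop :=
  ∀ a b, a ≤ l → b ≤ l → (rk c (r + (l + 1)) (r + a) < rk c (r + (l + 1)) (r + b) ↔ ρ a < ρ b)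

/-- The letters `r, …, r + l` of the code `c` are ordered like `ρ 0, …, ρ l`, and just below the
peak in position `P` there is an earlier letter that is not among them. -/
def HitAt (l P : ℕ) (ρ : ℕ → ℕ) (c : ℕ → ℕ) (r : ℕ) : Prop :=
  OccursAt l ρ c r ∧
    ∀ a, a ≤ l → a ≠ P → rk c (r + (l + 1)) (r + a) + 2 ≤ rk c (r + (l + 1)) (r + P)

variable {l P : ℕ} {ρ : ℕ → ℕ}

theorem occursAt_congr {c d : ℕ → ℕ} {r : ℕ} (h : ∀ i, r ≤ i → i ≤ r + l → c i = d i) :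
    OccursAt l ρ c r ↔ OccursAt l ρ d r := by
  have key : ∀ a ≤ l, rk c (r + (l + 1)) (r + a) = rk d (r + (l + 1)) (r + a) := fun a ha =>
    rk_congr (by omega) fun i hi hi' => h i (by omega) (by omega)
  unfold OccursAt
  refine forall₄_congr fun a b ha hb => ?_
  rw [key a ha, key b hb]

theorem hitAt_congr (hP : P ≤ l) {c d : ℕ → ℕ} {r : ℕ}
    (h : ∀ i, r ≤ i → i ≤ r + l → c i = d i) : HitAt l P ρ c r ↔ HitAt l P ρ d r := by
  have key : ∀ a ≤ l, rk c (r + (l + 1)) (r + a) = rk d (r + (l + 1)) (r + a) := fun a ha =>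
    rk_congr (by omega) fun i hi hi' => h i (by omega) (by omega)
  unfold HitAt
  refine and_congr (occursAt_congr h) (forall₃_congr fun a ha _ => ?_)
  rw [key a ha, key P hP]

theorem occursAt_shift (c : ℕ → ℕ) (r s : ℕ) :
    OccursAt l ρ (fun j => c (r + j)) s ↔ OccursAt l ρ c (r + s) := by
  unfold OccursAt
  refine forall₄_congr fun a b ha hb => ?_
  rw [rk_shift c r (by omega), rk_shift c r (by omega)]
  simp only [add_assoc]

theorem hitAt_shift (hP : P ≤ l) (c : ℕ → ℕ) (r s : ℕ) :
    HitAt l P ρ (fun j => c (r + j)) s ↔ HitAt l P ρ c (r + s) := by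
  unfold HitAt
  refine and_congr (occursAt_shift c r s) (forall₃_congr fun a ha _ => ?_)
  rw [rk_shift c r (by omega), rk_shift c r (by omega)]
  simp only [add_assoc]

theorem OccursAt.iff_of_le {c : ℕ → ℕ} {r N a b : ℕ} (h : OccursAt l ρ c r) (hN : r + l < N)
    (ha : a ≤ l) (hb : b ≤ l) : rk c N (r + a) < rk c N (r + b) ↔ ρ a < ρ b := by
  rw [rk_lt_rk_iff c (n := r + (l + 1)) (by omega) (by omega) (by omega), h a b ha hb]

/-- Two occurrences of a peaked word overlap in at most one letter. -/
theorem IsPeaked.not_overlap (h : IsPeaked l P ρ) {c : ℕ → ℕ} {r δ : ℕ} (hδ : 0 < δ) (hδl : δ < l)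
    (h1 : OccursAt l ρ c r) (h2 : OccursAt l ρ c (r + δ)) : False := by
  have hP := h.pos
  have hPl := h.lt
  have key : ∀ a, a + 1 ≤ l → δ + a + 1 ≤ l → (ρ (δ + a) < ρ (δ + (a + 1)) ↔ ρ a < ρ (a + 1)) := by
    intro a ha ha'
    rw [← h1.iff_of_le (N := r + δ + l + 1) (by omega) (by omega) (by omega),
      ← h2.iff_of_le (N := r + δ + l + 1) (by omega) (by omega) (by omega)]
    simp only [add_assoc]
  -- If `P ≤ δ`, the initial ascent of the second copy falls on a descent of the first. Otherwise
  -- the descent just after the first peak falls on an ascent of the second copy.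
  rcases le_or_gt P δ with hd | hd
  · have := (key 0 (by omega) (by omega)).2 (h.up 0 (0 + 1) (by omega) (by omega))
    exact lt_asymm this (h.down (δ + 0) (δ + (0 + 1)) (by omega) (by omega) (by omega))
  · have := (key (P - δ) (by omega) (by omega)).2
      (h.up (P - δ) (P - δ + 1) (by omega) (by omega))
    exact lt_asymm this (h.down (δ + (P - δ)) (δ + (P - δ + 1)) (by omega) (by omega) (by omega))

/-! ### The chain recursion -/

/-- The number of ways to insert a chain of `m` hits, any two consecutive ones sharing a letter,
into an order with `r` letters. -/
noncomputable def chainCount (l P : ℕ) (ρ : ℕ → ℕ) (m r : ℕ) : ℕ :=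
  {e | e ∈ codes r (m * l + 1) ∧ ∀ j < m, HitAt l P ρ e (j * l)}.ncard

/-- The number of codes without a hit among the first `t` letters that end in a chain of `m` hits,
starting with the last one of these letters. -/
noncomputable def tailCount (l P : ℕ) (ρ : ℕ → ℕ) (m t : ℕ) : ℕ :=
  {c | c ∈ codes 0 (t + m * l) ∧ (∀ r, r + l < t → ¬ HitAt l P ρ c r) ∧
    ∀ j < m, HitAt l P ρ c (t - 1 + j * l)}.ncard

/-- Append a chain of `m` hits, starting at letter `r`, to a hit-free code of length `r`. Either no
hit ends at letter `r`, or one does and lengthens the chain at its front to `m + 1`. -/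
theorem IsPeaked.tailCount_rec (h : IsPeaked l P ρ) (m r : ℕ) :
    tailCount l P ρ 0 r * chainCount l P ρ m r =
      tailCount l P ρ m (r + 1) + if l ≤ r then tailCount l P ρ (m + 1) (r + 1 - l) else 0 := by
  have hP := h.pos
  have hPl := h.lt
  have h0 := ncard_codes_add 0 r (m * l + 1) (fun c => ∀ s, s + l < r → ¬ HitAt l P ρ c s)
    (fun e => ∀ j < m, HitAt l P ρ e (j * l)) (by
      intro c d hcd
      refine forall₂_congr fun s hs => not_congr (hitAt_congr hPl.le fun i hi hi' => ?_)
      exact hcd i (by omega))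
  simp only [hitAt_shift hPl.le, zero_add] at h0
  have e0 : tailCount l P ρ 0 r =
      {c | c ∈ codes 0 r ∧ ∀ s, s + l < r → ¬ HitAt l P ρ c s}.ncard := by
    simp [tailCount]
  have hr : r + (m * l + 1) = r + 1 + m * l := by ring
  rw [e0, chainCount, ← h0, hr]
  have hsplit : {c | c ∈ codes 0 (r + 1 + m * l) ∧ (∀ s, s + l < r → ¬ HitAt l P ρ c s) ∧
      ∀ j < m, HitAt l P ρ c (r + j * l)} =
      {c | c ∈ codes 0 (r + 1 + m * l) ∧ (∀ s, s + l < r + 1 → ¬ HitAt l P ρ c s) ∧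
        ∀ j < m, HitAt l P ρ c (r + 1 - 1 + j * l)} ∪
      {c | c ∈ codes 0 (r + 1 + m * l) ∧ (∀ s, s + l < r → ¬ HitAt l P ρ c s) ∧
        (∀ j < m, HitAt l P ρ c (r + j * l)) ∧ l ≤ r ∧ HitAt l P ρ c (r - l)} := by
    ext c
    simp only [Set.mem_ofPred_eq, Set.mem_union, Nat.add_sub_cancel]
    constructor
    · rintro ⟨h1, h2, h3⟩
      by_cases h4 : l ≤ r ∧ HitAt l P ρ c (r - l)
      · exact Or.inr ⟨h1, h2, h3, h4⟩
      · refine Or.inl ⟨h1, fun s hs hh => ?_, h3⟩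
        rcases Nat.lt_succ_iff_lt_or_eq.1 hs with h5 | h5
        · exact h2 s h5 hh
        · exact h4 ⟨by omega, by rwa [← h5, Nat.add_sub_cancel]⟩
    · rintro (⟨h1, h2, h3⟩ | ⟨h1, h2, h3, -⟩)
      · exact ⟨h1, fun s hs => h2 s (by omega), h3⟩
      · exact ⟨h1, h2, h3⟩
  rw [hsplit, Set.ncard_union_eq ?_ (Set.Finite.subset (codes_finite 0 _) fun c hc => hc.1)
    (Set.Finite.subset (codes_finite 0 _) fun c hc => hc.1)]
  · congr 1
    split_ifs with hlr
    · unfold tailCount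
      congr 1
      have hlen : r + 1 - l + (m + 1) * l = r + 1 + m * l := by
        rw [add_mul]; omega
      rw [hlen]
      ext c
      simp only [Set.mem_ofPred_eq]
      refine and_congr_right fun _ => ?_
      have hs : r + 1 - l - 1 = r - l := by omega
      rw [hs]
      have hj : ∀ j, r - l + (j + 1) * l = r + j * l := by
        intro j; rw [add_mul]; omega
      constructor
      · rintro ⟨h2, h3, -, h4⟩
        refine ⟨fun s hs => h2 s (by omega), fun j hj' => ?_⟩
        rcases j with _ | j
        · simpa using h4
        · rw [hj]; exact h3 j (by omega)
      · rintro ⟨h2, h3⟩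
        have h4 : HitAt l P ρ c (r - l) := by simpa using h3 0 (by omega)
        refine ⟨fun s hs hh => ?_, fun j hj' => ?_, hlr, h4⟩
        -- A hit not covered by `h2` would share at least two letters with the hit at `r - l`.
        · by_cases h5 : s + l < r + 1 - l
          · exact h2 s h5 hh
          · have h6 : r - l = s + (r - l - s) := by omega
            have h4' := h4.1
            rw [h6] at h4'
            exact h.not_overlap (by omega) (by omega) hh.1 h4'
        · rw [← hj]; exact h3 (j + 1) (by omega)
    · rw [Set.ncard_eq_zero (Set.Finite.subset (codes_finite 0 _) fun c hc => hc.1)]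
      exact Set.eq_empty_iff_forall_notMem.2 fun c hc => hlr hc.2.2.2.1
  · refine Set.disjoint_left.2 fun c hc hc' => ?_
    obtain ⟨-, -, -, h4, h5⟩ := hc'
    exact hc.2.1 (r - l) (by omega) h5

/-- The recursion expresses the value at `(m, r + 1)` through smaller second arguments. The case `t
= 0`, `m > 0` is excluded because `t - 1` would be truncated there. -/
theorem tailCount_eq {P' : ℕ} {ρ' : ℕ → ℕ} (h : IsPeaked l P ρ) (h' : IsPeaked l P' ρ')
    (hK : ∀ m r, chainCount l P ρ m r = chainCount l P' ρ' m r) (t : ℕ) :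
    ∀ m, (m = 0 ∨ 0 < t) → tailCount l P ρ m t = tailCount l P' ρ' m t := by
  induction t using Nat.strong_induction_on with
  | _ t ih =>
    intro m hm
    rcases t with _ | r
    · obtain rfl : m = 0 := by omega
      simp [tailCount]
    · have e1 := h.tailCount_rec m r
      have e2 := h'.tailCount_rec m r
      have hl := h.pos
      have hl' := h.lt
      rw [ih r (by omega) 0 (Or.inl rfl), hK, e2] at e1
      split_ifs at e1 with hlr
      · rw [ih (r + 1 - l) (by omega) (m + 1) (Or.inr (by omega))] at e1
        omega
      · omega

/-! ### The gap below the peak -/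

/-- After `n` insertions the letter `p` exceeds all other letters `r, …, n - 1` by at least `g`. -/
def GapAt (c : ℕ → ℕ) (r p g n : ℕ) : Prop :=
  ∀ s, r ≤ s → s < n → s ≠ p → rk c n s + g ≤ rk c n p

/-- Since `g > 0`, the new letter must land below `p` and so raises the rank of `p` by one; this
explains the `+ 1`. -/
theorem gapAt_succ_iff {c : ℕ → ℕ} {r p g n : ℕ} (hg : 0 < g) (hr : r ≤ p) (hp : p < n) :
    GapAt c r p g (n + 1) ↔ GapAt c r p g n ∧ c n + g ≤ rk c n p + 1 := by
  constructor
  · intro h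
    have hn := h n (by omega) (by omega) (by omega)
    rw [rk_succ_self, rk_succ_of_lt _ hp, skip] at hn
    have hn' : c n + g ≤ rk c n p + 1 := by split_ifs at hn <;> omega
    refine ⟨fun s hs hsn hsp => ?_, hn'⟩
    have := h s hs (by omega) hsp
    rw [rk_succ_of_lt _ hsn, rk_succ_of_lt _ hp, skip, skip] at this
    split_ifs at this <;> omega
  · rintro ⟨h, hn⟩ s hs hsn hsp
    rw [rk_succ_of_lt _ hp, skip, if_neg (by omega)]
    rcases Nat.lt_succ_iff_lt_or_eq.1 hsn with h1 | rfl
    · rw [rk_succ_of_lt _ h1]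
      have := h s hs h1 hsp
      have := skip_le (c n) (rk c n s)
      omega
    · rw [rk_succ_self]
      exact hn

theorem GapAt.of_le {c : ℕ → ℕ} {r p g n N : ℕ} (hg : 0 < g) (hr : r ≤ p) (hp : p < n)
    (hN : n ≤ N) (h : GapAt c r p g N) : GapAt c r p g n := by
  induction N, hN using Nat.le_induction with
  | base => exact h
  | succ N hN ih => exact ih ((gapAt_succ_iff hg hr (by omega)).1 h).1

/-- Lowering the code of the largest letter `p` by one lowers the gap below it by one and does not
affect the ranks of the other letters. -/
theorem gapAt_two_iff {c d : ℕ → ℕ} {r p N : ℕ} (hr : r ≤ p)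
    (hcd : ∀ i, r ≤ i → i < N → i ≠ p → c i = d i) (hp : c p = d p + 1) (hpN : p < N) :
    (GapAt c r p 2 N ↔ GapAt d r p 1 N) ∧
      (GapAt d r p 1 N → (∀ s, r ≤ s → s < N → s ≠ p → rk c N s = rk d N s) ∧
        rk c N p = rk d N p + 1) := by
  induction N, (Nat.succ_le_of_lt hpN) using Nat.le_induction with
  | base =>
    have key : ∀ s, r ≤ s → s < p → rk c p s = rk d p s := fun s hs hsp =>
      rk_congr hsp fun i hi hi' => hcd i (by omega) (by omega) (by omega)
    have hgap : ∀ (e : ℕ → ℕ) (g : ℕ), 0 < g →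
        (GapAt e r p g (p + 1) ↔ ∀ s, r ≤ s → s < p → rk e p s + g ≤ e p) := by
      intro e g hg
      constructor
      · intro h s hs hsp
        have := h s hs (by omega) hsp.ne
        rw [rk_succ_self, rk_succ_of_lt _ hsp] at this
        have := le_skip (e p) (rk e p s)
        omega
      · intro h s hs hsp hne
        have := h s hs (by omega)
        rw [rk_succ_self, rk_succ_of_lt _ (by omega), skip, if_pos (by omega)]
        exact this
    constructor
    · rw [Nat.succ_eq_add_one, hgap c 2 (by omega), hgap d 1 (by omega)]
      refine forall₃_congr fun s hs hsp => ?_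
      rw [key s hs hsp]
      omega
    · intro h
      have h' := (hgap d 1 (by omega)).1 h
      refine ⟨fun s hs hsp hne => ?_, by rw [Nat.succ_eq_add_one, rk_succ_self, rk_succ_self, hp]⟩
      have := h' s hs (by omega)
      rw [Nat.succ_eq_add_one, rk_succ_of_lt _ (by omega), rk_succ_of_lt _ (by omega),
        key s hs (by omega), hp, skip, skip, if_pos (by omega), if_pos (by omega)]
  | succ n hn ih =>
    obtain ⟨h1, h2⟩ := ih (fun i hi hi' => hcd i hi (by omega)) (by omega)
    have hcn : c n = d n := hcd n (by omega) (by omega) (by omega)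
    rw [gapAt_succ_iff (by omega) hr (by omega), gapAt_succ_iff (by omega) hr (by omega), h1]
    constructor
    · refine and_congr_right fun h => ?_
      rw [(h2 h).2, hcn]
      omega
    · rintro ⟨h, hd⟩
      obtain ⟨h3, h4⟩ := h2 h
      refine ⟨fun s hs hsn hsp => ?_, ?_⟩
      · rcases Nat.lt_succ_iff_lt_or_eq.1 hsn with h5 | rfl
        · rw [rk_succ_of_lt _ h5, rk_succ_of_lt _ h5, h3 s hs h5 hsp, hcn]
        · rw [rk_succ_self, rk_succ_self, hcn]
      · rw [rk_succ_of_lt _ (by omega), rk_succ_of_lt _ (by omega), h4, hcn, skip, skip,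
          if_neg (by omega), if_neg (by omega)]

theorem gapAt_iff_forall {c : ℕ → ℕ} {r g : ℕ} :
    GapAt c r (r + P) g (r + (l + 1)) ↔
      ∀ a, a ≤ l → a ≠ P → rk c (r + (l + 1)) (r + a) + g ≤ rk c (r + (l + 1)) (r + P) := by
  constructor
  · exact fun h a ha haP => h (r + a) (by omega) (by omega) (by omega)
  · intro h s hs hsl hsp
    have := h (s - r) (by omega) (by omega)
    rwa [Nat.add_sub_cancel' hs] at this

/-- In an occurrence the peak dominates the block, which is a gap of one; raising its code by one
makes this a gap of two and keeps the order of the block. -/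
theorem IsPeaked.hitAt_iff_occursAt (h : IsPeaked l P ρ) {c d : ℕ → ℕ} {r : ℕ}
    (hcd : ∀ a, a ≤ l → a ≠ P → c (r + a) = d (r + a)) (hp : c (r + P) = d (r + P) + 1) :
    HitAt l P ρ c r ↔ OccursAt l ρ d r := by
  have hPl := h.lt
  obtain ⟨h1, h2⟩ := gapAt_two_iff (c := c) (d := d) (r := r) (p := r + P) (N := r + (l + 1))
    (by omega) (fun i hi hi' hne => by
      have := hcd (i - r) (by omega) (by omega)
      rwa [Nat.add_sub_cancel' hi] at this) hp (by omega)
  have h3 : GapAt d r (r + P) 1 (r + (l + 1)) → (OccursAt l ρ c r ↔ OccursAt l ρ d r) := by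
    intro hg
    obtain ⟨h4, h5⟩ := h2 hg
    refine forall₄_congr fun a b ha hb => iff_congr ?_ Iff.rfl
    have hg' := gapAt_iff_forall.1 hg
    have e : ∀ a, a ≤ l → a ≠ P → rk c (r + (l + 1)) (r + a) = rk d (r + (l + 1)) (r + a) :=
      fun a ha haP => h4 _ (by omega) (by omega) (by omega)
    by_cases haP : a = P <;> by_cases hbP : b = P
    · rw [haP, hbP]; simp
    · have := hg' b hb hbP
      rw [haP, h5, e b hb hbP]; omega
    · have := hg' a ha haP
      rw [hbP, h5, e a ha haP]; omega
    · rw [e a ha haP, e b hb hbP]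
  constructor
  · rintro ⟨h4, h5⟩
    exact (h3 (h1.1 (gapAt_iff_forall.2 h5))).1 h4
  · intro h4
    have hg : GapAt d r (r + P) 1 (r + (l + 1)) :=
      gapAt_iff_forall.2 fun a ha haP => (h4 a P ha hPl.le).2 (h.lt_peak ha haP)
    exact ⟨(h3 hg).2 h4, gapAt_iff_forall.1 (h1.2 hg)⟩

/-- In a hit, no letter other than the peak is larger than all letters inserted before it. -/
theorem HitAt.code_lt {c : ℕ → ℕ} {r R : ℕ} (hPl : P < l) (h : HitAt l P ρ c r)
    (hc : ∀ j < r + (l + 1), c j ≤ R + j) {a : ℕ} (ha : a ≤ l) (haP : a ≠ P) :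
    c (r + a) < R + (r + a) := by
  have hg : GapAt c r (r + P) 2 (r + (l + 1)) := gapAt_iff_forall.2 h.2
  rcases lt_or_gt_of_ne haP with hlt | hgt
  · by_contra hcon
    -- If the letter `r + a` enters on top, the overall maximum stays inside the block until the
    -- peak arrives, and the peak cannot exceed it by two.
    have top : ∀ n, r + a + 1 ≤ n → n ≤ r + P → ∃ s, r ≤ s ∧ s < n ∧ R + n ≤ rk c n s + 1 := by
      intro n hn
      induction n, hn using Nat.le_induction with
      | base => exact fun _ => ⟨r + a, by omega, by omega, by rw [rk_succ_self]; omega⟩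
      | succ n hn ih =>
        intro hnP
        obtain ⟨s, hs, hsn, hs'⟩ := ih (by omega)
        rcases lt_or_ge (rk c n s) (c n) with h1 | h1
        · exact ⟨n, by omega, by omega, by rw [rk_succ_self]; omega⟩
        · refine ⟨s, hs, by omega, ?_⟩
          rw [rk_succ_of_lt _ hsn, skip, if_neg (by omega)]
          omega
    obtain ⟨s, hs, hsn, hs'⟩ := top (r + P) (by omega) le_rfl
    have h1 := (hg.of_le (n := r + P + 1) (by omega) (by omega) (by omega) (by omega)) s hs
      (by omega) (by omega)
    rw [rk_succ_self, rk_succ_of_lt _ hsn] at h1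
    have := le_skip (c (r + P)) (rk c (r + P) s)
    have := hc (r + P) (by omega)
    omega
  · have h1 := (hg.of_le (n := r + a + 1) (by omega) (by omega) (by omega) (by omega)) (r + a)
      (by omega) (by omega) (by omega)
    rw [rk_succ_self] at h1
    have := rk_le (c := c) (R := R) (n := r + a + 1) (s := r + P)
      (fun j hj => hc j (by omega)) (by omega)
    omega

/-! ### From chains of hits to chains of occurrences -/

/-- The number of ways to insert a chain of `m` occurrences of `ρ`, any two consecutive ones sharing
a letter, into an order with `r` letters. -/
noncomputable def freeChainCount (l : ℕ) (ρ : ℕ → ℕ) (m r : ℕ) : ℕ :=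
  {e | e ∈ codes r (m * l + 1) ∧ ∀ j < m, OccursAt l ρ e (j * l)}.ncard

theorem exists_block {m j : ℕ} (hl : 0 < l) (hm : 0 < m) (hj : j < m * l + 1) :
    ∃ i < m, ∃ a ≤ l, j = i * l + a := by
  rcases Nat.lt_succ_iff_lt_or_eq.1 hj with h | rfl
  · exact ⟨j / l, (Nat.div_lt_iff_lt_mul hl).2 h, j % l, (Nat.mod_lt _ hl).le,
      (Nat.div_add_mod' j l).symm⟩
  · obtain ⟨m, rfl⟩ : ∃ m', m = m' + 1 := ⟨m - 1, by omega⟩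
    exact ⟨m, by omega, l, le_rfl, by ring⟩

theorem block_le {m i a : ℕ} (hi : i < m) (ha : a ≤ l) : i * l + a < m * l + 1 := by
  have : (i + 1) * l ≤ m * l := Nat.mul_le_mul_right _ hi
  rw [add_mul] at this
  omega

/-- The peak is interior, so letters shared by neighbouring blocks are never peaks, and the peaks of
a chain form one residue class modulo `l`. -/
theorem IsPeaked.block_mod (h : IsPeaked l P ρ) {i a : ℕ} (ha : a ≤ l) :
    (i * l + a) % l = P ↔ a = P := by
  have hP := h.pos
  have hPl := h.lt
  rw [Nat.mul_add_mod']
  rcases ha.lt_or_eq with h1 | rfl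
  · rw [Nat.mod_eq_of_lt h1]
  · rw [Nat.mod_self]; omega

/-- The first letter of a hit is not a peak, so by `HitAt.code_lt` it cannot enter on top; with no
earlier letters it would have to. -/
theorem IsPeaked.chainCount_zero (h : IsPeaked l P ρ) {m : ℕ} (hm : 0 < m) :
    chainCount l P ρ m 0 = 0 := by
  unfold chainCount
  rw [Set.ncard_eq_zero (Set.Finite.subset (codes_finite 0 _) fun c hc => hc.1)]
  refine Set.eq_empty_iff_forall_notMem.2 fun e he => ?_
  have hP := h.pos
  have := (he.2 0 hm).code_lt (R := 0) h.lt (fun j hj => he.1.1 j (by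
    have := block_le (l := l) hm le_rfl
    omega)) (a := 0) (by omega) (by omega)
  omega

theorem IsPeaked.chainCount_succ (h : IsPeaked l P ρ) {m : ℕ} (hm : 0 < m) (R : ℕ) :
    chainCount l P ρ m (R + 1) = freeChainCount l ρ m R := by
  have hP := h.pos
  have hPl := h.lt
  unfold chainCount freeChainCount
  symm
  have hocc : ∀ c d : ℕ → ℕ,
      (∀ j, j < m * l + 1 → c j = d j + if j % l = P then 1 else 0) →
      ∀ i < m, (HitAt l P ρ c (i * l) ↔ OccursAt l ρ d (i * l)) := by
    intro c d hcd i hi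
    refine h.hitAt_iff_occursAt (fun a ha haP => ?_) ?_
    · rw [hcd _ (block_le hi ha), if_neg (mt (h.block_mod ha).1 haP), add_zero]
    · rw [hcd _ (block_le hi hPl.le), if_pos ((h.block_mod hPl.le).2 rfl)]
  refine Set.ncard_congr
    (fun d _ j => d j + if j < m * l + 1 ∧ j % l = P then 1 else 0) ?_ ?_ ?_
  · rintro d ⟨hd, hd'⟩
    refine ⟨⟨fun j hj => ?_, fun j hj => ?_⟩, fun i hi => (hocc _ d ?_ i hi).2 (hd' i hi)⟩
    · have := hd.1 j hj
      dsimp only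
      split_ifs <;> omega
    · have := hd.2 j hj
      dsimp only
      rw [if_neg (by omega)]; omega
    · intro j hj
      simp [hj]
  · intro d d' _ _ hdd
    funext j
    have := congrFun hdd j
    omega
  · rintro c ⟨hc, hc'⟩
    -- Peak codes are positive, so the truncated subtraction below is undone by adding one.
    have hpos : ∀ j, j < m * l + 1 → j % l = P → 0 < c j := by
      intro j hj hjP
      obtain ⟨i, hi, a, ha, rfl⟩ := exists_block (by omega) hm hj
      obtain rfl := (h.block_mod ha).1 hjP
      have h1 : GapAt c (i * l) (i * l + a) 2 (i * l + (l + 1)) :=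
        gapAt_iff_forall.2 (hc' i hi).2
      have h2 := (h1.of_le (n := i * l + a + 1) (by omega) (by omega) (by omega) (by omega)) (i * l)
        le_rfl (by omega) (by omega)
      rw [rk_succ_self] at h2
      omega
    -- Non-peak codes keep their value but must obey the bound for one earlier letter fewer.
    have hlt : ∀ j, j < m * l + 1 → j % l ≠ P → c j ≤ R + j := by
      intro j hj hjP
      obtain ⟨i, hi, a, ha, rfl⟩ := exists_block (by omega) hm hj
      have := (hc' i hi).code_lt (R := R + 1) hPl (fun j hj => hc.1 j (by
        have := block_le (l := l) hi le_rfl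
        omega)) ha (mt (h.block_mod ha).2 hjP)
      omega
    have hsum : ∀ j, c j - (if j < m * l + 1 ∧ j % l = P then 1 else 0) +
        (if j < m * l + 1 ∧ j % l = P then 1 else 0) = c j := by
      intro j
      split_ifs with hj
      · have := hpos j hj.1 hj.2
        omega
      · omega
    refine ⟨fun j => c j - if j < m * l + 1 ∧ j % l = P then 1 else 0,
      ⟨⟨fun j hj => ?_, fun j hj => ?_⟩, fun i hi => (hocc c _ ?_ i hi).1 (hc' i hi)⟩, ?_⟩
    · dsimp only
      split_ifs with hj'
      · have := hc.1 j hj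
        omega
      · have := hlt j hj (fun hh => hj' ⟨hj, hh⟩)
        omega
    · have := hc.2 j hj
      dsimp only
      omega
    · intro j hj
      have := hsum j
      simp only [hj, true_and] at this ⊢
      exact this.symm
    · funext j
      exact hsum j

/-! ### Reversing a chain -/

/-- Reversal of the positions from `r` on. -/
def revFrom (r L : ℕ) : Equiv.Perm (Fin (r + L)) :=
  Function.Involutive.toPerm
    (fun s => if h : (s : ℕ) < r then s else ⟨r + L - 1 - (s - r), by have := s.2; omega⟩) (by
      intro s
      have := s.2
      by_cases h : (s : ℕ) < r
      · simp [h]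
      · have h' : ¬ (r + L - 1 - (s - r) < r) := by omega
        simp only [h, h', dite_false]
        apply Fin.ext
        dsimp only
        omega)

theorem revFrom_apply {r L s : ℕ} (hs : s < L) :
    revFrom r L ⟨r + s, by omega⟩ = ⟨r + (L - 1 - s), by omega⟩ := by
  have h : ¬ (r + s < r) := by omega
  refine (dif_neg h).trans (Fin.ext ?_)
  dsimp only
  omega

/-- The permutations with occurrences of `ρ` in the `m` blocks that form a chain from `r` on. -/
def chainPerms (l : ℕ) (ρ : ℕ → ℕ) (m r : ℕ) : Set (Equiv.Perm (Fin (r + (m * l + 1)))) :=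
  {w | ∀ i, ∀ hi : i < m, ∀ a b, ∀ ha : a ≤ l, ∀ hb : b ≤ l,
    (w ⟨r + (i * l + a), Nat.add_lt_add_left (block_le hi ha) r⟩ <
      w ⟨r + (i * l + b), Nat.add_lt_add_left (block_le hi hb) r⟩ ↔ ρ a < ρ b)}

/-- The first `r` letters are unconstrained and give the factor `r!`. Passing to genuine
permutations makes reversal of positions available, which is awkward on codes. -/
theorem ncard_chainPerms (l : ℕ) (ρ : ℕ → ℕ) (m r : ℕ) :
    (chainPerms l ρ m r).ncard = r.factorial * freeChainCount l ρ m r := by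
  have h := ncard_codes_add 0 r (m * l + 1) (fun _ => True)
    (fun e => ∀ i < m, OccursAt l ρ e (i * l)) (by simp)
  simp only [true_and, and_true, Set.ofPred_mem_eq, zero_add, ncard_codes, occursAt_shift] at h
  rw [freeChainCount, ← h]
  refine ncard_perm_eq _ _ _ fun c => ?_
  refine forall₂_congr fun i hi => forall₄_congr fun a b ha hb => iff_congr ?_ Iff.rfl
  have := block_le (l := l) hi le_rfl
  have key := rk_lt_rk_iff c.1 (n := r + i * l + (l + 1)) (N := r + (m * l + 1))
    (s := r + i * l + a) (t := r + i * l + b) (by omega) (by omega) (by omega)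
  rw [add_assoc r (i * l) a, add_assoc r (i * l) b] at key ⊢
  exact key

/-- Reversal exchanges the blocks `i` and `m - 1 - i` and reverses each of them, so a chain goes to
a chain of the reversed word. -/
theorem revFrom_block {m r i a : ℕ} (hi : i < m) (ha : a ≤ l) :
    revFrom r (m * l + 1) ⟨r + (i * l + a), Nat.add_lt_add_left (block_le hi ha) r⟩ =
      ⟨r + ((m - 1 - i) * l + (l - a)),
        Nat.add_lt_add_left (block_le (by omega) (Nat.sub_le _ _)) r⟩ := by
  rw [revFrom_apply (block_le hi ha)]
  have : m * l = (m - 1 - i) * l + i * l + l := by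
    rw [← add_mul, ← Nat.succ_mul]
    congr 1
    omega
  apply Fin.ext
  dsimp only
  omega

theorem mul_revFrom_mem {m r : ℕ} {w : Equiv.Perm (Fin (r + (m * l + 1)))}
    (hw : w ∈ chainPerms l ρ m r) :
    w * revFrom r (m * l + 1) ∈ chainPerms l (fun a => ρ (l - a)) m r := by
  intro i hi a b ha hb
  rw [Equiv.Perm.mul_apply, Equiv.Perm.mul_apply, revFrom_block hi ha, revFrom_block hi hb]
  exact hw (m - 1 - i) (by omega) (l - a) (l - b) (by omega) (by omega)

theorem freeChainCount_rev (l : ℕ) (ρ : ℕ → ℕ) (m r : ℕ) :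
    freeChainCount l (fun a => ρ (l - a)) m r = freeChainCount l ρ m r := by
  refine Nat.eq_of_mul_eq_mul_left r.factorial_pos ?_
  rw [← ncard_chainPerms, ← ncard_chainPerms]
  symm
  refine Set.ncard_congr (fun w _ => w * revFrom r (m * l + 1)) (fun w hw => mul_revFrom_mem hw)
    (fun w w' _ _ h => mul_right_cancel h) ?_
  intro w hw
  have hinv : revFrom r (m * l + 1) * revFrom r (m * l + 1) = 1 :=
    Equiv.ext fun s => Function.Involutive.toPerm_involutive _ s
  refine ⟨w * revFrom r (m * l + 1), ?_, by rw [mul_assoc, hinv, mul_one]⟩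
  intro i hi a b ha hb
  rw [mul_revFrom_mem hw i hi a b ha hb]
  dsimp only
  rw [Nat.sub_sub_self ha, Nat.sub_sub_self hb]

theorem IsPeaked.chainCount_rev (h : IsPeaked l P ρ) (m r : ℕ) :
    chainCount l P ρ m r = chainCount l (l - P) (fun a => ρ (l - a)) m r := by
  rcases Nat.eq_zero_or_pos m with rfl | hm
  · simp [chainCount]
  · rcases r with _ | R
    · rw [h.chainCount_zero hm, h.rev.chainCount_zero hm]
    · rw [h.chainCount_succ hm, h.rev.chainCount_succ hm, freeChainCount_rev]

/-! ### Hits and copies of the vincular pattern -/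

theorem exists_rk_eq {c : ℕ → ℕ} {n y : ℕ} (hc : ∀ j < n, c j ≤ j) (hy : y < n) :
    ∃ s < n, rk c n s = y := by
  have hinj : Function.Injective (fun s : Fin n =>
      (⟨rk c n s, by
        have := rk_le (R := 0) (fun j hj => (hc j hj).trans_eq (zero_add j).symm) s.2
        omega⟩ : Fin n)) :=
    fun s t h => Fin.ext (rk_injOn c s.2 t.2 (congrArg Fin.val h))
  obtain ⟨s, hs⟩ := (Finite.injective_iff_surjective.1 hinj) ⟨y, hy⟩
  exact ⟨s, s.2, congrArg Fin.val hs⟩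

theorem codePerm_mul_rev_apply {n : ℕ} (c : codes 0 n) (x : Fin n) {s : ℕ} (h : s + x + 1 = n) :
    ((codePerm n c * Fin.revPerm : Equiv.Perm (Fin n)) x : ℕ) = rk c n s := by
  rw [Equiv.Perm.mul_apply, codePerm_apply, Fin.revPerm_apply, Fin.val_rev]
  congr 1
  omega

/-- A hit is a copy of the vincular pattern `τ₁⋯τₖ-k`, read from right to left. -/
theorem IsPeaked.exists_isCopy (hρ : IsPeaked l P ρ) (τ : Equiv.Perm (Fin (l + 1 + 1)))
    (hτ : ∀ x : Fin (l + 1 + 1), (x : ℕ) ≤ l → (τ x : ℕ) = ρ (l - x))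
    (hlast : (τ (Fin.last (l + 1)) : ℕ) = l) (hpeak : ρ P = l + 1)
    (hlow : ∀ a ≤ l, a ≠ P → ρ a < l) {n r : ℕ} (c : codes 0 n) (hr : r + l < n)
    (h : HitAt l P ρ c r) :
    ∃ f, (VincularPattern.dashLast τ).IsCopy (codePerm n c * Fin.revPerm) f := by
  have hP := hρ.pos
  have hPl := hρ.lt
  obtain ⟨h1, h2⟩ := h
  have hc : ∀ j < r + (l + 1), c.1 j ≤ j := fun j hj => by
    simpa using c.2.1 j (by omega)
  have hle : rk c (r + (l + 1)) (r + P) + 1 ≤ r + (l + 1) := by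
    simpa using rk_le (R := 0) (fun j hj => (hc j hj).trans_eq (zero_add j).symm)
      (s := r + P) (by omega)
  have h0 := h2 0 (by omega) (by omega)
  -- The letter just below the peak plays the part after the dash. The gap of two keeps it out of
  -- the block, hence `u < r`.
  obtain ⟨u, hu, huy⟩ := exists_rk_eq hc
    (show rk c (r + (l + 1)) (r + P) - 1 < r + (l + 1) by omega)
  have hur : u < r := by
    by_contra hcon
    obtain ⟨a, rfl⟩ := Nat.exists_eq_add_of_le (not_lt.1 hcon)
    by_cases haP : a = P
    · subst haP; omega
    · have := h2 a (by omega) haP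
      omega
  set g : Fin (l + 1 + 1) → ℕ := fun x => if (x : ℕ) ≤ l then r + (l - x) else u with hg
  have hg1 : ∀ x : Fin (l + 1 + 1), (x : ℕ) ≤ l → g x = r + (l - x) := fun x hx => if_pos hx
  have hg2 : ∀ x : Fin (l + 1 + 1), ¬ (x : ℕ) ≤ l → g x = u := fun x hx => if_neg hx
  have hgM : ∀ x, g x < r + (l + 1) := by
    intro x
    by_cases hx : (x : ℕ) ≤ l
    · rw [hg1 x hx]; omega
    · rw [hg2 x hx]; omega
  have hτl : ∀ x : Fin (l + 1 + 1), ¬ (x : ℕ) ≤ l → (τ x : ℕ) = l := by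
    intro x hx
    have hx' : x = Fin.last (l + 1) := Fin.ext (by rw [Fin.val_last]; omega)
    rw [hx', hlast]
  have hval : ∀ x (hx : n - 1 - g x < n),
      ((codePerm n c * Fin.revPerm : Equiv.Perm (Fin n)) ⟨n - 1 - g x, hx⟩ : ℕ) = rk c n (g x) := fun x hx =>
    codePerm_mul_rev_apply c _ (by
      have := hgM x
      dsimp only
      omega)
  refine ⟨fun x => ⟨n - 1 - g x, by omega⟩, fun x y hxy => ?_, fun x y => ?_, fun x y hx hxy => ?_⟩
  · rw [Fin.lt_def] at hxy ⊢
    dsimp only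
    have hx : (x : ℕ) ≤ l := by have := y.2; omega
    rw [hg1 x hx]
    by_cases hy : (y : ℕ) ≤ l
    · rw [hg1 y hy]; omega
    · rw [hg2 y hy]; omega
  · rw [Fin.lt_def, hval, hval, rk_lt_rk_iff c.1 (hgM x) (hgM y) (by omega)]
    change _ ↔ τ x < τ y
    rw [Fin.lt_def]
    have key : ∀ a ≤ l, (rk c (r + (l + 1)) u < rk c (r + (l + 1)) (r + a) ↔ l < ρ a) ∧
        (rk c (r + (l + 1)) (r + a) < rk c (r + (l + 1)) u ↔ ρ a < l) := by
      intro a ha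
      by_cases haP : a = P
      · subst haP; omega
      · have := hlow a ha haP
        have := h2 a ha haP
        omega
    by_cases hx : (x : ℕ) ≤ l <;> by_cases hy : (y : ℕ) ≤ l
    · rw [hg1 x hx, hg1 y hy, hτ x hx, hτ y hy]
      exact h1 _ _ (Nat.sub_le _ _) (Nat.sub_le _ _)
    · rw [hg1 x hx, hg2 y hy, hτ x hx, hτl y hy]
      exact (key _ (Nat.sub_le _ _)).2
    · rw [hg2 x hx, hg1 y hy, hτl x hx, hτ y hy]
      exact (key _ (Nat.sub_le _ _)).1
    · rw [hg2 x hx, hg2 y hy, hτl x hx, hτl y hy]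
      simp
  · have hx' : (x : ℕ) < l := by simpa [VincularPattern.dashLast] using hx
    dsimp only
    rw [hg1 x (by omega), hg1 y (by omega)]
    omega

theorem IsPeaked.exists_hitAt (hρ : IsPeaked l P ρ) (τ : Equiv.Perm (Fin (l + 1 + 1)))
    (hτ : ∀ x : Fin (l + 1 + 1), (x : ℕ) ≤ l → (τ x : ℕ) = ρ (l - x))
    (hlast : (τ (Fin.last (l + 1)) : ℕ) = l) (hpeak : ρ P = l + 1)
    (hlow : ∀ a ≤ l, a ≠ P → ρ a < l) {n : ℕ} (c : codes 0 n) {f : Fin (l + 1 + 1) → Fin n}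
    (hf : (VincularPattern.dashLast τ).IsCopy (codePerm n c * Fin.revPerm) f) :
    ∃ r, r + l < n ∧ HitAt l P ρ c r := by
  have hPl := hρ.lt
  obtain ⟨hmono, hord, hadj⟩ := hf
  have hpos : ∀ a (ha : a ≤ l), (f ⟨a, by omega⟩ : ℕ) = (f 0 : ℕ) + a := by
    intro a
    induction a with
    | zero => intro _; rfl
    | succ a ih =>
      intro ha
      rw [hadj ⟨a, by omega⟩ ⟨a + 1, by omega⟩
        (by simp only [VincularPattern.dashLast, Finset.mem_range]; omega) rfl, ih (by omega)]
      rfl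
  have hl := hpos l le_rfl
  have hfl := (f ⟨l, by omega⟩).2
  have hz : f ⟨l, by omega⟩ < f (Fin.last (l + 1)) := hmono (by simp [Fin.lt_def])
  rw [Fin.lt_def] at hz
  have hzn := (f (Fin.last (l + 1))).2
  -- The adjacent part of the copy ends at position `f 0 + l`, which is its first letter when read
  -- from the right.
  refine ⟨n - 1 - ((f 0 : ℕ) + l), by omega, ?_⟩
  set r := n - 1 - ((f 0 : ℕ) + l) with hr
  have hval : ∀ a, a ≤ l → ∀ h : l - a < l + 1 + 1,
      ((codePerm n c * Fin.revPerm : Equiv.Perm (Fin n)) (f ⟨l - a, h⟩) : ℕ) = rk c n (r + a) := fun a ha h =>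
    codePerm_mul_rev_apply c _ (by
      rw [hpos (l - a) (Nat.sub_le _ _)]
      omega)
  have hτ' : ∀ a, a ≤ l → ∀ h : l - a < l + 1 + 1, (τ ⟨l - a, h⟩ : ℕ) = ρ a := by
    intro a ha h
    rw [hτ _ (Nat.sub_le _ _)]
    dsimp only
    rw [Nat.sub_sub_self ha]
  have hvall := codePerm_mul_rev_apply c (f (Fin.last (l + 1)))
    (s := n - 1 - f (Fin.last (l + 1))) (by omega)
  set u := n - 1 - (f (Fin.last (l + 1)) : ℕ) with hu
  refine ⟨fun a b ha hb => ?_, fun a ha haP => ?_⟩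
  · have h1 := hord ⟨l - a, by omega⟩ ⟨l - b, by omega⟩
    rw [Fin.lt_def, hval a ha, hval b hb] at h1
    change _ ↔ τ _ < τ _ at h1
    rw [Fin.lt_def, hτ' a ha, hτ' b hb] at h1
    rw [← h1]
    exact (rk_lt_rk_iff _ (by omega) (by omega) (by omega)).symm
  · have h1 := hord ⟨l - a, by omega⟩ (Fin.last (l + 1))
    have h2 := hord (Fin.last (l + 1)) ⟨l - P, by omega⟩
    rw [Fin.lt_def, hval a ha, hvall] at h1
    rw [Fin.lt_def, hval P hPl.le, hvall] at h2
    change _ ↔ τ _ < τ _ at h1 h2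
    rw [Fin.lt_def, hτ' a ha, hlast] at h1
    rw [Fin.lt_def, hτ' P hPl.le, hlast] at h2
    have h3 := h1.2 (hlow a ha haP)
    have h4 := h2.2 (by omega)
    rw [rk_lt_rk_iff c.1 (n := r + (l + 1)) (by omega) (by omega) (by omega)] at h3 h4
    omega

theorem IsPeaked.ncard_avoiders (hρ : IsPeaked l P ρ) (τ : Equiv.Perm (Fin (l + 1 + 1)))
    (hτ : ∀ x : Fin (l + 1 + 1), (x : ℕ) ≤ l → (τ x : ℕ) = ρ (l - x))
    (hlast : (τ (Fin.last (l + 1)) : ℕ) = l) (hpeak : ρ P = l + 1)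
    (hlow : ∀ a ≤ l, a ≠ P → ρ a < l) (n : ℕ) :
    ((VincularPattern.dashLast τ).avoiders n).ncard = tailCount l P ρ 0 n := by
  have h1 : ((VincularPattern.dashLast τ).avoiders n).ncard =
      {w : Equiv.Perm (Fin n) | (VincularPattern.dashLast τ).Avoids (w * Fin.revPerm)}.ncard := by
    have hrev : (Fin.revPerm : Equiv.Perm (Fin n)) * Fin.revPerm = 1 :=
      Equiv.ext fun s => Fin.rev_rev s
    symm
    refine Set.ncard_congr (fun w _ => w * Fin.revPerm) (fun w hw => hw)
      (fun w w' _ _ h => mul_right_cancel h) fun w hw => ⟨w * Fin.revPerm, ?_, ?_⟩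
    · change (VincularPattern.dashLast τ).Avoids _
      rw [mul_assoc, hrev, mul_one]
      exact hw
    · rw [mul_assoc, hrev, mul_one]
  rw [h1, ncard_perm_eq n _ (fun c => ∀ r, r + l < n → ¬ HitAt l P ρ c r)]
  · simp [tailCount]
  · intro c
    constructor
    · exact fun h r hr hh => h (hρ.exists_isCopy τ hτ hlast hpeak hlow c hr hh)
    · rintro h ⟨f, hf⟩
      obtain ⟨r, hr, hh⟩ := hρ.exists_hitAt τ hτ hlast hpeak hlow c hf
      exact h r hr hh

/-! ### One-line notation and the theorem -/

/-- The letters of a permutation in one-line notation, as natural numbers. -/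
def oneLine {k : ℕ} (τ : Equiv.Perm (Fin k)) (a : ℕ) : ℕ :=
  if h : a < k then τ ⟨a, h⟩ else 0

theorem oneLine_eq {k : ℕ} (τ : Equiv.Perm (Fin k)) (x : Fin k) : oneLine τ x = τ x :=
  dif_pos x.2

theorem revInitial_apply {k : ℕ} (τ : Equiv.Perm (Fin (k + 1))) {a : ℕ} (ha : a < k) :
    revInitial τ ⟨a, by omega⟩ = τ ⟨k - 1 - a, by omega⟩ := by
  have h : revInitialPos k (⟨a, ha⟩ : Fin k).castSucc = (⟨a, ha⟩ : Fin k).rev.castSucc := by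
    change Fin.lastCases (motive := fun _ => Fin (k + 1)) (Fin.last k)
      (fun a : Fin k => a.rev.castSucc) _ = _
    rw [Fin.lastCases_castSucc]
  refine congrArg τ (h.trans (Fin.ext ?_))
  rw [Fin.val_castSucc, Fin.val_rev]
  dsimp only
  omega

theorem revInitial_last {k : ℕ} (τ : Equiv.Perm (Fin (k + 1))) :
    revInitial τ (Fin.last k) = τ (Fin.last k) := by
  have h : revInitialPos k (Fin.last k) = Fin.last k := by
    change Fin.lastCases (motive := fun _ => Fin (k + 1)) (Fin.last k)
      (fun a : Fin k => a.rev.castSucc) _ = _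
    rw [Fin.lastCases_last]
  exact congrArg τ h

theorem wilfEquiv_revInitial (τ : Equiv.Perm (Fin (l + 1 + 1)))
    (h : IsPeaked l P (oneLine τ)) (hlast : (τ (Fin.last (l + 1)) : ℕ) = l)
    (hpeak : oneLine τ P = l + 1) (hlow : ∀ a ≤ l, a ≠ P → oneLine τ a < l) :
    (VincularPattern.dashLast τ).WilfEquiv (VincularPattern.dashLast (revInitial τ)) := by
  have hPl := h.lt
  intro n
  -- Hits are read from right to left, so `τ` goes with the reversed word and `revInitial τ` with
  -- the word itself.
  rw [h.rev.ncard_avoiders τ ?_ hlast ?_ ?_ n, h.ncard_avoiders (revInitial τ) ?_ ?_ hpeak hlow n]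
  · exact (tailCount_eq h h.rev h.chainCount_rev n 0 (Or.inl rfl)).symm
  · intro x hx
    have := revInitial_apply τ (a := x) (by omega)
    rw [Fin.eta] at this
    rw [this, ← oneLine_eq]
    rfl
  · rw [revInitial_last, hlast]
  · intro x hx
    rw [Nat.sub_sub_self hx, oneLine_eq]
  · rw [Nat.sub_sub_self hPl.le, hpeak]
  · intro a ha haP
    exact hlow _ (Nat.sub_le _ _) (by omega)

theorem mainTheorem3 (k i : ℕ) (hk : 3 ≤ k) (hi : 2 ≤ i) (hik : i ≤ k - 1)
    (σ τ : Equiv.Perm (Fin (k + 1)))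
    (hinc : ∀ a b : Fin (k + 1), a < b → (b : ℕ) ≤ i - 1 → σ a < σ b)
    (hdec : ∀ a b : Fin (k + 1), i - 1 ≤ (a : ℕ) → a < b → b < Fin.last k → σ b < σ a)
    (hlast : σ (Fin.last k) = Fin.last k)
    (hτ : τ = Equiv.swap (⟨k - 1, by omega⟩ : Fin (k + 1)) (Fin.last k) * σ) :
    (VincularPattern.dashLast τ).WilfEquiv (VincularPattern.dashLast (revInitial τ)) := by
  obtain ⟨l, rfl⟩ : ∃ l, k = l + 1 := ⟨k - 1, by omega⟩
  have hσ : ∀ a (ha : a ≤ l), (σ ⟨a, by omega⟩ : ℕ) ≤ l := by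
    intro a ha
    by_contra hcon
    have h1 : σ ⟨a, by omega⟩ = σ (Fin.last (l + 1)) := by
      rw [hlast]
      exact Fin.ext (by rw [Fin.val_last]; omega)
    have := congrArg Fin.val (σ.injective h1)
    simp at this
    omega
  have hval : ∀ a (ha : a ≤ l), oneLine τ a =
      if (σ ⟨a, by omega⟩ : ℕ) = l then l + 1 else (σ ⟨a, by omega⟩ : ℕ) := by
    intro a ha
    have h1 := hσ a ha
    rw [oneLine, dif_pos (by omega), hτ, Equiv.Perm.mul_apply, Equiv.swap_apply_def]
    split_ifs with h2 h3 h4 h5 h5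
    · rfl
    · exact (h3 (congrArg Fin.val h2)).elim
    · rw [h4] at h1
      simp at h1
    · rw [h4] at h1
      simp at h1
    · exact (h2 (Fin.ext h5)).elim
    · rfl
  have hlt : ∀ a b (ha : a ≤ l) (hb : b ≤ l), σ ⟨a, by omega⟩ < σ ⟨b, by omega⟩ →
      oneLine τ a < oneLine τ b := by
    intro a b ha hb h
    rw [Fin.lt_def] at h
    have h1 := hσ a ha
    have h2 := hσ b hb
    rw [hval a ha, hval b hb]
    split_ifs <;> omega
  have hpk : ∀ a (ha : a ≤ l), a ≠ i - 1 → σ ⟨a, by omega⟩ < σ ⟨i - 1, by omega⟩ := by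
    intro a ha hai
    rcases lt_or_gt_of_ne hai with h | h
    · exact hinc _ _ h le_rfl
    · exact hdec _ _ le_rfl h (by rw [Fin.lt_def, Fin.val_last]; dsimp only; omega)
  -- The letter `l` occurs among the first `l + 1` positions, and the peak dominates these, so the
  -- swap raises exactly the peak, to `l + 1`.
  have htop : (σ ⟨i - 1, by omega⟩ : ℕ) = l := by
    obtain ⟨x, hx⟩ := σ.surjective ⟨l, by omega⟩
    have hxl : (x : ℕ) ≤ l := by
      by_contra hcon
      have : x = Fin.last (l + 1) := Fin.ext (by rw [Fin.val_last]; omega)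
      rw [this, hlast] at hx
      simpa using congrArg Fin.val hx
    have h1 := hσ (i - 1) (by omega)
    by_cases hxi : (x : ℕ) = i - 1
    · have h2 : x = ⟨i - 1, by omega⟩ := Fin.ext hxi
      rw [← h2, hx]
    · have h2 := hpk x hxl hxi
      rw [Fin.eta, hx, Fin.lt_def] at h2
      dsimp only at h2
      omega
  -- The bounds `2 ≤ i ≤ k - 1` say that the peak is interior, `0 < i - 1 < l`.
  refine wilfEquiv_revInitial (P := i - 1) τ ⟨by omega, by omega, ?_, ?_⟩ ?_ ?_ ?_
  · intro a b hab hb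
    exact hlt a b (by omega) (by omega) (hinc _ _ hab hb)
  · intro a b ha hab hb
    refine hlt b a hb (by omega) (hdec _ _ ha hab ?_)
    rw [Fin.lt_def, Fin.val_last]
    dsimp only
    omega
  · rw [hτ, Equiv.Perm.mul_apply, hlast, Equiv.swap_apply_right]
    rfl
  · rw [hval _ (by omega), if_pos htop]
  · intro a ha hai
    have h1 := hpk a ha hai
    rw [Fin.lt_def, htop] at h1
    rw [hval a ha, if_neg (by omega)]
    exact h1
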